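/- Let $d\ge 1$ and let $\sigma=(\sigma_0,\ldots,\sigma_{d-1})\in\{+,-\}^d$. Identify a monic real polynomial $Q=x^d+\sum_{j=0}^{d-1}a_jx^j$ with the point $(a_0,\ldots,a_{d-1})\in\mathbb{R}^d$, and say that $Q$ has sign pattern $\sigma$ if $\operatorname{sign}(a_j)=\sigma_j$ for $0\le j\le d-1$ (in particular, all $a_j\neq 0$). Sets of polynomials carry the topology induced from $\mathbb{R}^d$; a contractible set is in particular non-empty. (1) If $d$ is even and $\sigma_0=+$, then the set $\mathcal{E}_d(\sigma)$ of polynomials with sign pattern $\sigma$ having no real roots is non-empty and convex, hence contractible. (2) If $d$ is odd, then the set $\mathcal{F}_d(\sigma)$ of polynomials with sign pattern $\sigma$ having exactly one real root, this root being simple, is non-empty and contractible. (3) Let $d$ be even, and let $\mathcal{G}_d(\sigma)$ be the set of polynomials with sign pattern $\sigma$ having exactly two real roots, both simple. If $\sigma_0=-$, then the two real roots of every polynomial of $\mathcal{G}_d(\sigma)$ have opposite signs, and $\mathcal{G}_d(\sigma)$ is contractible. If $\sigma_0=+$, let $\mathcal{G}_{d,(2,0)}(\sigma)$ (resp. $\mathcal{G}_{d,(0,2)}(\sigma)$)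 be the subset of $\mathcal{G}_d(\sigma)$ of polynomials whose two real roots are both positive (resp. both negative). Each of these two sets is contractible or empty. The set $\mathcal{G}_{d,(2,0)}(\sigma)$ is empty exactly when one of the following holds: - Case 1): the constant term and all coefficients of odd degree are positive, and at least one coefficient of even degree is negative; - all signs $\sigma_j$ are $+$ (so that positive roots are excluded by Descartes' rule of signs). The set $\mathcal{G}_{d,(0,2)}(\sigma)$ is empty exactly when one of the following holds: - Case 2): the constant term is positive, all coefficients of odd degree are negative, and at least one coefficient of even degree is negative; - $\sigma_j=(-1)^j$ for all $j$ (so that negative roots are excluded by Descartes' rule of signs). -/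

import Mathlib

namespace SignedPoly

open Polynomial

noncomputable section

/-- The monic real polynomial `x ^ d + ∑_{j < d} a_j x ^ j` with coefficient vector `a`. -/
def poly {d : ℕ} (a : Fin d → ℝ) : ℝ[X] :=
  X ^ d + ∑ j : Fin d, C (a j) * X ^ (j : ℕ)

/-- Coefficient vectors whose signs are prescribed by `σ`. -/
def signRegion {d : ℕ} (σ : Fin d → SignType) : Set (Fin d → ℝ) :=
  {a | ∀ j, SignType.sign (a j) = σ j}

/-- Elliptic polynomials (no real root) with coefficient signs `σ`. -/
def ellipticSet {d : ℕ} (σ : Fin d → SignType) : Set (Fin d → ℝ) :=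
  {a | a ∈ signRegion σ ∧ ∀ x : ℝ, ¬ (poly a).IsRoot x}

/-- Polynomials with coefficient signs `σ` and exactly one real root, which is simple
(`roots` is the multiset of real roots, counted with multiplicity). -/
def oneRootSet {d : ℕ} (σ : Fin d → SignType) : Set (Fin d → ℝ) :=
  {a | a ∈ signRegion σ ∧ ∃ ξ : ℝ, (poly a).roots = {ξ}}

/-- Polynomials with coefficient signs `σ` and exactly two real roots, both simple. -/
def twoRootSet {d : ℕ} (σ : Fin d → SignType) : Set (Fin d → ℝ) :=
  {a | a ∈ signRegion σ ∧ ∃ ξ η : ℝ, ξ < η ∧ (poly a).roots = {ξ, η}}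

/-- The members of `twoRootSet σ` with one negative and one positive root. -/
def twoRootSetOpposite {d : ℕ} (σ : Fin d → SignType) : Set (Fin d → ℝ) :=
  {a | a ∈ signRegion σ ∧ ∃ ξ η : ℝ, ξ < 0 ∧ 0 < η ∧ (poly a).roots = {ξ, η}}

/-- The members of `twoRootSet σ` with two positive roots. -/
def twoRootSetPos {d : ℕ} (σ : Fin d → SignType) : Set (Fin d → ℝ) :=
  {a | a ∈ signRegion σ ∧ ∃ ξ η : ℝ, 0 < ξ ∧ ξ < η ∧ (poly a).roots = {ξ, η}}

/-- The members of `twoRootSet σ` with two negative roots. -/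
def twoRootSetNeg {d : ℕ} (σ : Fin d → SignType) : Set (Fin d → ℝ) :=
  {a | a ∈ signRegion σ ∧ ∃ ξ η : ℝ, ξ < η ∧ η < 0 ∧ (poly a).roots = {ξ, η}}

/-- Case 1), as a condition on signs: constant term and all odd-degree coefficients positive,
some even-degree coefficient negative. -/
def Case1 {d : ℕ} (σ : Fin d → SignType) : Prop :=
  (∀ j : Fin d, (j : ℕ) = 0 → σ j = 1) ∧ (∀ j : Fin d, Odd (j : ℕ) → σ j = 1) ∧
    ∃ j : Fin d, Even (j : ℕ) ∧ σ j = -1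

/-- Case 2), as a condition on signs: constant term positive, all odd-degree coefficients
negative, some even-degree coefficient negative. -/
def Case2 {d : ℕ} (σ : Fin d → SignType) : Prop :=
  (∀ j : Fin d, (j : ℕ) = 0 → σ j = 1) ∧ (∀ j : Fin d, Odd (j : ℕ) → σ j = -1) ∧
    ∃ j : Fin d, Even (j : ℕ) ∧ σ j = -1

end

end SignedPoly

namespace SignedPoly

open Polynomial Filter Topology Set

lemma poly_degree_tail {d : ℕ} (a : Fin d → ℝ) :
    (∑ j : Fin d, C (a j) * X ^ (j : ℕ)).degree < (d : WithBot ℕ) := by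
  refine (degree_sum_le _ _).trans_lt ?_
  refine (Finset.sup_lt_iff (WithBot.bot_lt_coe d)).2 fun j _ => ?_
  exact (degree_C_mul_X_pow_le _ _).trans_lt (Nat.cast_lt.2 j.2)

lemma poly_monic {d : ℕ} (a : Fin d → ℝ) : (poly a).Monic :=
  monic_X_pow_add (poly_degree_tail a)

lemma poly_natDegree {d : ℕ} (a : Fin d → ℝ) : (poly a).natDegree = d := by
  apply natDegree_eq_of_degree_eq_some
  rw [poly, degree_add_eq_left_of_degree_lt, degree_X_pow]
  rw [degree_X_pow]; exact poly_degree_tail a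

lemma poly_eval {d : ℕ} (a : Fin d → ℝ) (x : ℝ) :
    (poly a).eval x = x ^ d + ∑ j : Fin d, a j * x ^ (j : ℕ) := by
  simp [poly, eval_finsetSum]

lemma poly_coeff_self {d : ℕ} {p : ℝ[X]} (hp : p.Monic) (hd : p.natDegree = d) :
    poly (fun j : Fin d => p.coeff j) = p := by
  conv_rhs => rw [hp.as_sum, hd]
  rw [poly, Finset.sum_range]

lemma poly_coeff {d : ℕ} (a : Fin d → ℝ) (j : Fin d) : (poly a).coeff j = a j := by
  rw [poly, coeff_add, coeff_X_pow, if_neg j.2.ne, zero_add, finsetSum_coeff,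
    Finset.sum_eq_single j]
  · simp
  · intro i _ hij
    rw [coeff_C_mul_X_pow, if_neg fun h => hij (Fin.ext h.symm)]
  · simp

lemma continuous_poly_eval {d : ℕ} (x : ℝ) :
    Continuous fun a : Fin d → ℝ => (poly a).eval x := by
  simp_rw [poly_eval]; fun_prop

lemma poly_eval_zero {d : ℕ} (hd : 0 < d) (a : Fin d → ℝ) : (poly a).eval 0 = a ⟨0, hd⟩ := by
  rw [poly_eval, Finset.sum_eq_single ⟨0, hd⟩]
  · simp [hd.ne']
  · intro j _ hj
    have : (j : ℕ) ≠ 0 := fun h => hj (Fin.ext h)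
    simp [this]
  · simp

lemma poly_combo {d : ℕ} (a b : Fin d → ℝ) (s t : ℝ) (h : s + t = 1) :
    poly (s • a + t • b) = C s * poly a + C t * poly b := by
  simp only [poly, Pi.add_apply, Pi.smul_apply, smul_eq_mul, C_add, C_mul, add_mul,
    Finset.sum_add_distrib, mul_add, Finset.mul_sum, mul_assoc]
  have : (C s + C t) * X ^ d = (X : ℝ[X]) ^ d := by rw [← C_add, h, C_1, one_mul]
  linear_combination -this

lemma poly_add_smul {d : ℕ} (a b : Fin d → ℝ) (t : ℝ) :
    poly (a + t • b) = poly a + C t * ∑ j : Fin d, C (b j) * X ^ (j : ℕ) := by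
  simp only [poly, Pi.add_apply, Pi.smul_apply, smul_eq_mul, C_add, C_mul, add_mul,
    Finset.sum_add_distrib, Finset.mul_sum, mul_assoc]
  ring

/-- A monic real polynomial without real roots is positive. -/
lemma Monic.eval_pos_of_roots_eq_zero {p : ℝ[X]} (hp : p.Monic) (h : p.roots = 0) (x : ℝ) :
    0 < p.eval x := by
  have hr : ∀ y, p.eval y ≠ 0 := fun y hy => by
    have : y ∈ p.roots := (mem_roots hp.ne_zero).2 hy
    simp [h] at this
  by_contra hx
  have hx : p.eval x < 0 := lt_of_le_of_ne (not_lt.1 hx) (hr x)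
  rcases Nat.eq_zero_or_pos p.natDegree with h0 | h0
  · rw [hp.natDegree_eq_zero.1 h0] at hx
    norm_num at hx
  · have ht := p.tendsto_atTop_of_leadingCoeff_nonneg (natDegree_pos_iff_degree_pos.1 h0)
      (by rw [hp.leadingCoeff]; exact zero_le_one)
    obtain ⟨y, hy⟩ := (ht.eventually_gt_atTop 0).exists
    obtain ⟨z, hz⟩ := mem_range_of_exists_le_of_exists_ge p.continuous ⟨x, hx.le⟩ ⟨y, hy.le⟩
    exact hr z hz

/-- The real roots of a monic polynomial are `s` iff it is `∏ (X - r)` times a positive polynomial. -/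
lemma Monic.roots_eq_iff {p : ℝ[X]} (hp : p.Monic) (s : Multiset ℝ) :
    p.roots = s ↔ ∃ q : ℝ[X], p = (s.map fun r => X - C r).prod * q ∧ ∀ x, 0 < q.eval x := by
  constructor
  · rintro rfl
    obtain ⟨q, hq, -, hr⟩ := exists_prod_multiset_X_sub_C_mul p
    refine ⟨q, hq.symm, Monic.eval_pos_of_roots_eq_zero ?_ hr⟩
    exact (monic_multiset_prod_of_monic _ _ fun r _ => monic_X_sub_C r).of_mul_monic_left (hq ▸ hp)
  · rintro ⟨q, hq, hpos⟩
    have hq0 : q.roots = 0 := by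
      refine Multiset.eq_zero_of_forall_notMem fun x hx => ?_
      exact (hpos x).ne' (isRoot_of_mem_roots hx)
    rw [hq, roots_mul (hq ▸ hp.ne_zero), roots_multiset_prod_X_sub_C, hq0, add_zero]

lemma convex_signRegion {d : ℕ} (σ : Fin d → SignType) (hσ : ∀ j, σ j ≠ 0) :
    Convex ℝ (signRegion σ) := by
  intro a ha b hb s t hs ht hst j
  have h1 := ha j
  have h2 := hb j
  have key : ∀ u v : ℝ, 0 < u → 0 < v → 0 < s * u + t * v := by
    intro u v hu hv
    rcases hs.eq_or_lt with rfl | hs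
    · have : t = 1 := by linarith
      subst this; linarith
    · have := mul_pos hs hu
      have := mul_nonneg ht hv.le
      linarith
  rcases hj : σ j with _ | _ | _
  · exact absurd hj (hσ j)
  · rw [hj] at h1 h2
    change SignType.sign (a j) = -1 at h1
    change SignType.sign (b j) = -1 at h2
    change SignType.sign (s * a j + t * b j) = -1
    rw [sign_eq_neg_one_iff] at *
    have := key (-a j) (-b j) (by linarith) (by linarith)
    linarith
  · rw [hj] at h1 h2
    change SignType.sign (a j) = 1 at h1
    change SignType.sign (b j) = 1 at h2
    change SignType.sign (s * a j + t * b j) = 1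
    rw [sign_eq_one_iff] at *
    exact key _ _ h1 h2

lemma isOpen_signRegion {d : ℕ} (σ : Fin d → SignType) (hσ : ∀ j, σ j ≠ 0) :
    IsOpen (signRegion σ) := by
  have : signRegion σ = ⋂ j, {a | SignType.sign (a j) = σ j} := by
    ext a; simp [signRegion]
  rw [this]
  refine isOpen_iInter_of_finite fun j => ?_
  rcases hj : σ j with _ | _ | _
  · exact absurd hj (hσ j)
  · have : {a : Fin d → ℝ | SignType.sign (a j) = SignType.neg} = {a | a j < 0} := by
      ext a; exact sign_eq_neg_one_iff
    rw [this]; exact isOpen_lt (continuous_apply j) continuous_const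
  · have : {a : Fin d → ℝ | SignType.sign (a j) = SignType.pos} = {a | 0 < a j} := by
      ext a; exact sign_eq_one_iff
    rw [this]; exact isOpen_lt continuous_const (continuous_apply j)

/-- Coefficient vectors with signs `σ` whose real roots, with multiplicity, are `s`. -/
def rootFiber {d : ℕ} (σ : Fin d → SignType) (s : Multiset ℝ) : Set (Fin d → ℝ) :=
  {a | a ∈ signRegion σ ∧ (poly a).roots = s}

lemma convex_rootFiber {d : ℕ} (σ : Fin d → SignType) (hσ : ∀ j, σ j ≠ 0) (s : Multiset ℝ) :
    Convex ℝ (rootFiber σ s) := by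
  intro a ha b hb u v hu hv huv
  refine ⟨convex_signRegion σ hσ ha.1 hb.1 hu hv huv, ?_⟩
  obtain ⟨q, hq, hqp⟩ := (Monic.roots_eq_iff (poly_monic a) s).1 ha.2
  obtain ⟨r, hr, hrp⟩ := (Monic.roots_eq_iff (poly_monic b) s).1 hb.2
  refine (Monic.roots_eq_iff (poly_monic _) s).2 ⟨C u * q + C v * r, ?_, fun x => ?_⟩
  · rw [poly_combo a b u v huv]
    nth_rw 1 [hq]; nth_rw 1 [hr]; ring
  · simp only [eval_add, eval_mul, eval_C]
    exact convex_Ioi (0 : ℝ) (hqp x) (hrp x) hu hv huv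

/-- Perturbation: a vector `t` with the right roots, whose vanishing coordinates can be corrected
by a vector `r` with `∏ (X - root) ∣ ∑ r_j X ^ j`, gives a point of the fiber. -/
lemma rootFiber_nonempty_of_perturbation {d : ℕ} {σ : Fin d → SignType} (hσ : ∀ j, σ j ≠ 0)
    {s : Multiset ℝ} {t r : Fin d → ℝ} (ht : (poly t).roots = s)
    (hr : (s.map fun r => X - C r).prod ∣ ∑ j : Fin d, C (r j) * X ^ (j : ℕ))
    (hsign : ∀ j, SignType.sign (t j) = σ j ∨ t j = 0 ∧ SignType.sign (r j) = σ j) :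
    (rootFiber σ s).Nonempty := by
  obtain ⟨q, hq, hqp⟩ := (Monic.roots_eq_iff (poly_monic t) s).1 ht
  obtain ⟨w, hw⟩ := hr
  have hm : (s.map fun r => X - C r).prod.Monic :=
    monic_multiset_prod_of_monic _ _ fun r _ => monic_X_sub_C r
  have hdeg : w.degree ≤ q.degree := by
    have h1 := poly_degree_tail r
    have h2 : (poly t).degree = d := by
      rw [degree_eq_natDegree (poly_monic t).ne_zero, poly_natDegree]
    rw [← h2, hw, hq, degree_mul, degree_mul] at h1
    exact (lt_of_add_lt_add_left h1).le
  have hO := isBigO_cobounded_of_degree_le hdeg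
  obtain ⟨K, hK⟩ := hO.bound
  rw [Metric.cobounded_eq_cocompact, Filter.eventually_iff, mem_cocompact] at hK
  obtain ⟨S, hS, hSK⟩ := hK
  obtain ⟨M, hM⟩ := hS.exists_bound_of_continuousOn (f := fun x => w.eval x / q.eval x)
    (w.continuous.div q.continuous fun x => (hqp x).ne').continuousOn
  set L := max (max K M) 0 + 1
  have hL : 0 < L := by positivity
  have hwq : ∀ x, |w.eval x| < L * q.eval x := by
    intro x
    have hx := hqp x
    have : |w.eval x| ≤ max (max K M) 0 * q.eval x := by
      by_cases hxS : x ∈ S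
      · have := hM x hxS
        rw [Real.norm_eq_abs, abs_div, abs_of_pos hx, div_le_iff₀ hx] at this
        exact this.trans (mul_le_mul_of_nonneg_right (by simp) hx.le)
      · have := hSK hxS
        simp only [mem_ofPred_eq, Real.norm_eq_abs, abs_of_pos hx] at this
        exact this.trans (mul_le_mul_of_nonneg_right (by simp) hx.le)
    simp only [L]; linarith
  have hev : ∀ᶠ ε : ℝ in 𝓝[>] 0, ∀ j, SignType.sign ((t + ε • r) j) = σ j := by
    rw [eventually_all]
    intro j
    rcases hsign j with h | ⟨h0, h⟩
    · have hc : Tendsto (fun ε : ℝ => (t + ε • r) j) (𝓝[>] 0) (𝓝 (t j)) := by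
        have : Continuous fun ε : ℝ => (t + ε • r) j := by simp; fun_prop
        have := this.tendsto 0
        simp only [zero_smul, add_zero] at this
        exact this.mono_left nhdsWithin_le_nhds
      rcases lt_trichotomy (t j) 0 with hj | hj | hj
      · filter_upwards [hc.eventually_lt_const hj] with ε hε
        rw [← h, sign_neg hε, sign_neg hj]
      · exact absurd (h ▸ by simp [hj]) (hσ j)
      · filter_upwards [hc.eventually_const_lt hj] with ε hε
        rw [← h, sign_pos hε, sign_pos hj]
    · filter_upwards [self_mem_nhdsWithin] with ε hε
      rw [← h]
      simp [h0, sign_mul, sign_pos (show (0:ℝ) < ε from hε)]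
  have hsm : ∀ᶠ ε : ℝ in 𝓝[>] 0, ε < 1 / L :=
    nhdsWithin_le_nhds (eventually_lt_nhds (by positivity))
  obtain ⟨ε, ⟨he1, he2⟩, he3⟩ := ((hev.and hsm).and self_mem_nhdsWithin).exists
  have he3 : 0 < ε := he3
  refine ⟨t + ε • r, he1, (Monic.roots_eq_iff (poly_monic _) s).2 ⟨q + C ε * w, ?_, fun x => ?_⟩⟩
  · rw [poly_add_smul, hw]; nth_rw 1 [hq]; ring
  · simp only [eval_add, eval_mul, eval_C]
    have h1 := hwq x
    have h2 : ε * |w.eval x| ≤ 1 / L * |w.eval x| :=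
      mul_le_mul_of_nonneg_right he2.le (abs_nonneg _)
    have h3 : 1 / L * |w.eval x| < q.eval x := by
      rw [one_div, inv_mul_lt_iff₀ hL]; exact h1
    have h4 := mul_le_mul_of_nonneg_left (neg_abs_le (w.eval x)) he3.le
    linarith

/-- A set that fibers over a convex set, with convex fibers and local sections, is contractible. -/
lemma contractibleSpace_of_convex_fibers {E F : Type*} [NormedAddCommGroup E] [NormedSpace ℝ E]
    [NormedAddCommGroup F] [NormedSpace ℝ F] {S : Set E} {B : Set F}
    (hB : Convex ℝ B) (hne : B.Nonempty) (ρ : E → F) (hρ : ContinuousOn ρ S) (hm : MapsTo ρ S B)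
    (hconv : ∀ b ∈ B, Convex ℝ {a | a ∈ S ∧ ρ a = b})
    (hloc : ∀ b ∈ B, ∃ g : F → E, Continuous g ∧ ∀ᶠ y in 𝓝 b, y ∈ B → g y ∈ S ∧ ρ (g y) = y) :
    ContractibleSpace S := by
  have : ContractibleSpace B := hB.contractibleSpace hne
  obtain ⟨s, hs⟩ := exists_continuous_forall_mem_convex_of_local (X := B) (E := E)
    (t := fun b => {a | a ∈ S ∧ ρ a = b}) (fun b => hconv b b.2) (fun b => by
      obtain ⟨g, hg, hgev⟩ := hloc b b.2
      have h2 : ∀ᶠ y : B in 𝓝 b, ((y : F) ∈ B → g y ∈ S ∧ ρ (g y) = y) :=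
        continuous_subtype_val.continuousAt.eventually hgev
      exact ⟨_, h2, fun y => g y, (hg.comp continuous_subtype_val).continuousOn,
        fun y hy => hy y.2⟩)
  let f : C(S, B) := ⟨fun a => ⟨ρ a, hm a.2⟩,
    (continuousOn_iff_continuous_domRestrict.1 hρ).subtype_mk _⟩
  let g : C(B, S) := ⟨fun b => ⟨s b, (hs b).1⟩, s.continuous.subtype_mk _⟩
  have hf : Continuous fun a : S => s (f a) := s.continuous.comp f.continuous
  let H : (g.comp f).Homotopy (ContinuousMap.id S) :=
    { toFun := fun p => ⟨(1 - (p.1 : ℝ)) • s (f p.2) + (p.1 : ℝ) • (p.2 : E),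
        (hconv (ρ p.2) (hm p.2.2) (hs (f p.2)) ⟨p.2.2, rfl⟩ (sub_nonneg.2 p.1.2.2) p.1.2.1
          (by ring)).1⟩
      continuous_toFun := by
        refine Continuous.subtype_mk ?_ _
        have := hf.comp (continuous_snd (X := unitInterval))
        simp only [Function.comp_def] at this
        fun_prop
      map_zero_left := fun a => by ext; simp [g]
      map_one_left := fun a => by ext; simp }
  let e : ContinuousMap.HomotopyEquiv S B :=
    { toFun := f
      invFun := g
      left_inv := ⟨H⟩
      right_inv := by
        have : f.comp g = ContinuousMap.id B := by
          ext b; exact (hs b).2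
        rw [this] }
  exact e.contractibleSpace

lemma pair_unique {a b c e : ℝ} (hab : a < b) (hce : c < e)
    (h : ({a, b} : Multiset ℝ) = {c, e}) : a = c ∧ b = e := by
  have h1 : a ∈ ({c, e} : Multiset ℝ) := h ▸ by simp
  have h2 : b ∈ ({c, e} : Multiset ℝ) := h ▸ by simp
  have h3 : c ∈ ({a, b} : Multiset ℝ) := h ▸ by simp
  simp only [Multiset.insert_eq_cons, Multiset.mem_cons, Multiset.mem_singleton] at h1 h2 h3
  grind

lemma eval_of_roots_singleton {p : ℝ[X]} (hp : p.Monic) {ξ : ℝ} (h : p.roots = {ξ}) (x : ℝ) :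
    (0 < p.eval x ↔ ξ < x) ∧ (p.eval x < 0 ↔ x < ξ) := by
  obtain ⟨q, hq, hpos⟩ := (Monic.roots_eq_iff hp _).1 h
  rw [hq]
  have := hpos x
  simp [mul_pos_iff_of_pos_right this, mul_neg_iff, this, this.not_gt]

lemma eval_of_roots_pair {p : ℝ[X]} (hp : p.Monic) {ξ η : ℝ} (hlt : ξ < η) (h : p.roots = {ξ, η})
    (x : ℝ) : (0 < p.eval x ↔ x < ξ ∨ η < x) ∧ (p.eval x < 0 ↔ ξ < x ∧ x < η) := by
  obtain ⟨q, hq, hpos⟩ := (Monic.roots_eq_iff hp _).1 h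
  have := hpos x
  have he : p.eval x = (x - ξ) * (x - η) * q.eval x := by
    nth_rw 1 [hq]; simp
  rw [he, mul_pos_iff_of_pos_right this, mul_neg_iff, mul_pos_iff, mul_neg_iff]
  constructor
  · constructor
    · rintro (h | h) <;> [right; left] <;> linarith
    · rintro (h | h) <;> [right; left] <;> constructor <;> linarith
  · constructor
    · rintro (h | ⟨h, h'⟩)
      · linarith
      · rcases h with h | h <;> constructor <;> linarith
    · rintro ⟨h, h'⟩
      exact Or.inr ⟨Or.inl ⟨by linarith, by linarith⟩, this⟩

/-- A continuously varying root configuration `μ`, recovered continuously from the coefficients,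
gives a contractible union of fibers over a convex parameter set. -/
lemma contractibleSpace_iUnion_rootFiber {F : Type*} [NormedAddCommGroup F] [NormedSpace ℝ F]
    {d : ℕ} {σ : Fin d → SignType} (hσ : ∀ j, σ j ≠ 0) {B : Set F} (hB : Convex ℝ B)
    (hne : B.Nonempty) (μ : F → Multiset ℝ) (n : ℕ) (hn : ∀ y, (μ y).card = n)
    (hμ : ∀ (q : ℝ[X]) (j : ℕ), Continuous fun y => (((μ y).map fun r => X - C r).prod * q).coeff j)
    (hfib : ∀ y ∈ B, (rootFiber σ (μ y)).Nonempty)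
    (ρ : (Fin d → ℝ) → F) (hρ : ∀ y ∈ B, ∀ a ∈ rootFiber σ (μ y), ρ a = y)
    (hc : ContinuousOn ρ {a | ∃ y ∈ B, a ∈ rootFiber σ (μ y)}) :
    ContractibleSpace {a | ∃ y ∈ B, a ∈ rootFiber σ (μ y)} := by
  refine contractibleSpace_of_convex_fibers hB hne ρ hc ?_ ?_ ?_
  · rintro a ⟨y, hy, ha⟩
    rwa [hρ y hy a ha]
  · intro y hy
    have : {a | a ∈ {a | ∃ y ∈ B, a ∈ rootFiber σ (μ y)} ∧ ρ a = y} = rootFiber σ (μ y) := by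
      ext a
      constructor
      · rintro ⟨⟨z, hz, ha⟩, h⟩
        rwa [← h, hρ z hz a ha]
      · exact fun ha => ⟨⟨y, hy, ha⟩, hρ y hy a ha⟩
    rw [this]
    exact convex_rootFiber σ hσ _
  · intro y hy
    obtain ⟨a, ha⟩ := hfib y hy
    obtain ⟨q, hq, hpos⟩ := (Monic.roots_eq_iff (poly_monic a) _).1 ha.2
    have hmon : ∀ z, ((μ z).map fun r => X - C r).prod.Monic := fun z =>
      monic_multiset_prod_of_monic _ _ fun r _ => monic_X_sub_C r
    have hqm : q.Monic := (hmon y).of_mul_monic_left (hq ▸ poly_monic a)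
    have hm : ∀ z, (((μ z).map fun r => X - C r).prod * q).Monic := fun z => (hmon z).mul hqm
    have hdeg : ∀ z, (((μ z).map fun r => X - C r).prod * q).natDegree = d := fun z => by
      rw [← poly_natDegree a, hq, (hmon z).natDegree_mul hqm, (hmon y).natDegree_mul hqm,
        natDegree_multiset_prod_X_sub_C_eq_card, natDegree_multiset_prod_X_sub_C_eq_card, hn, hn]
    have hg : Continuous fun (z : F) (j : Fin d) =>
        (((μ z).map fun r => X - C r).prod * q).coeff j :=
      continuous_pi fun j => hμ q j
    refine ⟨_, hg, ?_⟩
    have hgy : (fun j : Fin d => (((μ y).map fun r => X - C r).prod * q).coeff j) ∈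
        signRegion σ := by
      have : (fun j : Fin d => (((μ y).map fun r => X - C r).prod * q).coeff j) = a := by
        ext j
        rw [← hq, poly_coeff]
      rw [this]; exact ha.1
    filter_upwards [hg.continuousAt.preimage_mem_nhds ((isOpen_signRegion σ hσ).mem_nhds hgy)]
      with z hz hzB
    have : (fun j : Fin d => (((μ z).map fun r => X - C r).prod * q).coeff j) ∈
        rootFiber σ (μ z) := by
      refine ⟨hz, ?_⟩
      rw [poly_coeff_self (hm z) (hdeg z)]
      exact (Monic.roots_eq_iff (hm z) _).2 ⟨q, rfl, hpos⟩
    exact ⟨⟨z, hzB, this⟩, hρ z hzB _ this⟩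

lemma contractibleSpace_iUnion_singleton {d : ℕ} {σ : Fin d → SignType} (hσ : ∀ j, σ j ≠ 0)
    {B : Set ℝ} (hB : Convex ℝ B) (hne : B.Nonempty)
    (hfib : ∀ ξ ∈ B, (rootFiber σ {ξ}).Nonempty) :
    ContractibleSpace {a | ∃ ξ ∈ B, a ∈ rootFiber σ {ξ}} := by
  have hsum : ∀ {a : Fin d → ℝ} {ξ : ℝ}, a ∈ rootFiber σ {ξ} → (poly a).roots.sum = ξ :=
    fun h => by rw [h.2, Multiset.sum_singleton]
  refine contractibleSpace_iUnion_rootFiber hσ hB hne (fun ξ => {ξ}) 1 (fun _ => rfl) ?_ hfib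
    (fun a => (poly a).roots.sum) (fun ξ _ a ha => hsum ha) ?_
  · intro q j
    simp only [Multiset.map_singleton, Multiset.prod_singleton, sub_mul, coeff_sub, coeff_C_mul]
    fun_prop
  · rintro a ⟨ξ, -, ha⟩
    rw [ContinuousWithinAt, hsum ha, tendsto_order]
    constructor
    · intro y hy
      have h1 := (eval_of_roots_singleton (poly_monic a) ha.2 y).2.2 hy
      filter_upwards [nhdsWithin_le_nhds
        ((continuous_poly_eval y).continuousAt.eventually_lt_const h1), self_mem_nhdsWithin]
        with b hb1 hb2
      obtain ⟨ζ, -, hb⟩ := hb2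
      rw [hsum hb]
      exact (eval_of_roots_singleton (poly_monic b) hb.2 y).2.1 hb1
    · intro y hy
      have h1 := (eval_of_roots_singleton (poly_monic a) ha.2 y).1.2 hy
      filter_upwards [nhdsWithin_le_nhds
        ((continuous_poly_eval y).continuousAt.eventually_const_lt h1), self_mem_nhdsWithin]
        with b hb1 hb2
      obtain ⟨ζ, -, hb⟩ := hb2
      rw [hsum hb]
      exact (eval_of_roots_singleton (poly_monic b) hb.2 y).1.1 hb1

/-- The two roots, in increasing order, of a polynomial with two real roots. -/
noncomputable def rootPair {d : ℕ} (a : Fin d → ℝ) : ℝ × ℝ :=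
  open Classical in
  if h : ∃ p : ℝ × ℝ, p.1 < p.2 ∧ (poly a).roots = {p.1, p.2} then h.choose else 0

lemma rootPair_eq {d : ℕ} {a : Fin d → ℝ} {p : ℝ × ℝ} (hp : p.1 < p.2)
    (h : (poly a).roots = {p.1, p.2}) : rootPair a = p := by
  have hex : ∃ p : ℝ × ℝ, p.1 < p.2 ∧ (poly a).roots = {p.1, p.2} := ⟨p, hp, h⟩
  rw [rootPair, dif_pos hex]
  obtain ⟨h1, h2⟩ := pair_unique hex.choose_spec.1 hp (hex.choose_spec.2.symm.trans h)
  exact Prod.ext h1 h2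

lemma continuousOn_rootPair {d : ℕ} {S : Set (Fin d → ℝ)}
    (hS : ∀ a ∈ S, ∃ p : ℝ × ℝ, p.1 < p.2 ∧ (poly a).roots = {p.1, p.2}) :
    ContinuousOn rootPair S := by
  intro a ha
  obtain ⟨p, hp, hpr⟩ := hS a ha
  obtain ⟨c, hc1, hc2⟩ := exists_between hp
  have hsgn := eval_of_roots_pair (poly_monic a) hp hpr
  have hneg : ∀ y, p.1 < y → y < p.2 → ∀ᶠ b in 𝓝[S] a, (poly b).eval y < 0 := fun y h1 h2 =>
    nhdsWithin_le_nhds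
      ((continuous_poly_eval y).continuousAt.eventually_lt_const ((hsgn y).2.2 ⟨h1, h2⟩))
  have hpos : ∀ y, (y < p.1 ∨ p.2 < y) → ∀ᶠ b in 𝓝[S] a, 0 < (poly b).eval y := fun y h =>
    nhdsWithin_le_nhds
      ((continuous_poly_eval y).continuousAt.eventually_const_lt ((hsgn y).1.2 h))
  have hSev : ∀ᶠ b in 𝓝[S] a, b ∈ S := self_mem_nhdsWithin
  have key : ∀ b ∈ S, ∀ y, ((poly b).eval y < 0 ↔ (rootPair b).1 < y ∧ y < (rootPair b).2) ∧
      (0 < (poly b).eval y ↔ y < (rootPair b).1 ∨ (rootPair b).2 < y) := by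
    intro b hb y
    obtain ⟨r, hr, hrr⟩ := hS b hb
    rw [rootPair_eq hr hrr]
    exact (eval_of_roots_pair (poly_monic b) hr hrr y).symm
  rw [ContinuousWithinAt, rootPair_eq hp hpr, nhds_prod_eq]
  refine Tendsto.prodMk ?_ ?_
  · rw [tendsto_order]
    constructor
    · intro y hy
      filter_upwards [hpos y (Or.inl hy), hneg c hc1 hc2, hSev] with b h1 h2 hb
      have h2 := (key b hb c).1.1 h2
      rcases (key b hb y).2.1 h1 with h | h
      · exact h
      · linarith
    · intro y hy
      filter_upwards [hneg (min y c) (lt_min hy hc1) (min_lt_of_right_lt hc2), hSev] with b h1 hb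
      exact ((key b hb _).1.1 h1).1.trans_le (min_le_left _ _)
  · rw [tendsto_order]
    constructor
    · intro y hy
      filter_upwards [hneg (max y c) (lt_max_of_lt_right hc1) (max_lt hy hc2), hSev] with b h1 hb
      exact (le_max_left _ _).trans_lt ((key b hb _).1.1 h1).2
    · intro y hy
      filter_upwards [hpos y (Or.inr hy), hneg c hc1 hc2, hSev] with b h1 h2 hb
      have h2 := (key b hb c).1.1 h2
      rcases (key b hb y).2.1 h1 with h | h
      · linarith
      · exact h

lemma contractibleSpace_iUnion_pair {d : ℕ} {σ : Fin d → SignType} (hσ : ∀ j, σ j ≠ 0)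
    {B : Set (ℝ × ℝ)} (hB : Convex ℝ B) (hne : B.Nonempty) (hlt : ∀ p ∈ B, p.1 < p.2)
    (hfib : ∀ p ∈ B, (rootFiber σ {p.1, p.2}).Nonempty) :
    ContractibleSpace {a | ∃ p ∈ B, a ∈ rootFiber σ {p.1, p.2}} := by
  refine contractibleSpace_iUnion_rootFiber hσ hB hne (fun p => {p.1, p.2}) 2 (fun _ => rfl) ?_
    hfib rootPair (fun p hp a ha => rootPair_eq (hlt p hp) ha.2) ?_
  · intro q j
    have : ∀ p : ℝ × ℝ, ((({p.1, p.2} : Multiset ℝ).map fun r => X - C r).prod * q).coeff j =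
        (X * X * q).coeff j - (p.1 + p.2) * (X * q).coeff j + p.1 * p.2 * q.coeff j := by
      intro p
      rw [← coeff_C_mul, ← coeff_C_mul, ← coeff_sub, ← coeff_add]
      congr 1
      simp only [Multiset.insert_eq_cons, Multiset.map_cons, Multiset.map_singleton,
        Multiset.prod_cons, Multiset.prod_singleton, C_add, C_mul]
      ring
    simp_rw [this]
    fun_prop
  · apply continuousOn_rootPair
    rintro a ⟨p, hp, ha⟩
    exact ⟨p, hlt p hp, ha.2⟩

lemma sign_signType_cast (s : SignType) : SignType.sign (s : ℝ) = s := by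
  rcases s with _ | _ | _ <;> simp

lemma ne_zero_of_odd_index {d : ℕ} (hd : 0 < d) {k : Fin d} (hk : Odd (k : ℕ)) :
    k ≠ ⟨0, hd⟩ := fun h => by simp [h] at hk

/-- The polynomial `∑ a_j X ^ j`, the part of `poly a` below the leading term. -/
noncomputable def tailPoly {d : ℕ} (a : Fin d → ℝ) : ℝ[X] :=
  ∑ j : Fin d, C (a j) * X ^ (j : ℕ)

lemma poly_eq_add_tailPoly {d : ℕ} (a : Fin d → ℝ) : poly a = X ^ d + tailPoly a := rfl

lemma tailPoly_add {d : ℕ} (a b : Fin d → ℝ) : tailPoly (a + b) = tailPoly a + tailPoly b := by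
  simp [tailPoly, add_mul, Finset.sum_add_distrib]

lemma tailPoly_single {d : ℕ} (k : Fin d) (c : ℝ) :
    tailPoly (Pi.single k c) = C c * X ^ (k : ℕ) := by
  rw [tailPoly, Finset.sum_eq_single k]
  · simp
  · intro i _ hi
    simp [Pi.single_eq_of_ne hi]
  · simp

lemma eval_self_derivative_X_sub_C_mul (ξ : ℝ) (q : ℝ[X]) :
    (derivative ((X - C ξ) * q)).eval ξ = q.eval ξ := by
  simp

lemma rootFiber_zero_nonempty {d : ℕ} (hd : 0 < d) (hev : Even d) {σ : Fin d → SignType}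
    (hσ : ∀ j, σ j ≠ 0) (h0 : σ ⟨0, hd⟩ = 1) : (rootFiber σ 0).Nonempty := by
  refine rootFiber_nonempty_of_perturbation hσ (t := Pi.single ⟨0, hd⟩ 1) (r := fun j => σ j)
    ?_ (by simp) ?_
  · rw [Monic.roots_eq_iff (poly_monic _)]
    refine ⟨_, (by simp; rfl), fun x => ?_⟩
    rw [poly_eq_add_tailPoly, tailPoly_single]
    have := hev.pow_nonneg x
    simp; linarith
  · intro j
    by_cases hj : j = ⟨0, hd⟩
    · left; rw [hj, h0]; simp
    · right; exact ⟨Pi.single_eq_of_ne hj _, sign_signType_cast _⟩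

lemma rootFiber_singleton_nonempty {d : ℕ} (hd : 0 < d) (hodd : Odd d) {σ : Fin d → SignType}
    (hσ : ∀ j, σ j ≠ 0) {ξ : ℝ} (h0 : SignType.sign (-ξ) = σ ⟨0, hd⟩) :
    (rootFiber σ {ξ}).Nonempty := by
  set z : Fin d := ⟨0, hd⟩
  have hξ : ξ ≠ 0 := by
    rintro rfl
    exact hσ z (by simpa using h0.symm)
  set g : Fin d → ℝ := fun j => if j = z then 0 else σ j with hg
  set v : ℝ := -(tailPoly g).eval ξ with hv
  refine rootFiber_nonempty_of_perturbation hσ (t := Pi.single z (-ξ ^ d))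
    (r := g + Pi.single z v) ?_ ?_ ?_
  · rw [Monic.roots_eq_iff (poly_monic _)]
    have hp : poly (Pi.single z (-ξ ^ d)) = X ^ d - C (ξ ^ d) := by
      rw [poly_eq_add_tailPoly, tailPoly_single]
      simp [z, sub_eq_add_neg]
    rw [hp]
    obtain ⟨q, hq⟩ : X - C ξ ∣ (X ^ d - C (ξ ^ d) : ℝ[X]) := by
      rw [dvd_iff_isRoot]; simp
    refine ⟨q, by simpa using hq, fun x => ?_⟩
    by_cases hx : x = ξ
    · subst hx
      rw [← eval_self_derivative_X_sub_C_mul, ← hq]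
      have he : Even (d - 1) := by
        obtain ⟨m, hm⟩ := hodd
        exact ⟨m, by omega⟩
      have := he.pow_pos hξ
      simp only [derivative_sub, derivative_X_pow, derivative_C, sub_zero, eval_mul, eval_pow,
        eval_X, map_natCast, eval_natCast]
      positivity
    · have h := congrArg (eval x) hq
      simp only [eval_sub, eval_pow, eval_X, eval_C, eval_mul] at h
      have hmono := hodd.strictMono_pow (R := ℝ)
      rcases lt_or_gt_of_ne hx with hx | hx
      · have := hmono hx
        simp only at this
        by_contra hc
        nlinarith [mul_nonneg_of_nonpos_of_nonpos (sub_neg.2 hx).le (not_lt.1 hc)]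
      · have := hmono hx
        simp only at this
        by_contra hc
        nlinarith [mul_nonpos_of_nonneg_of_nonpos (sub_pos.2 hx).le (not_lt.1 hc)]
  · simp only [Multiset.map_singleton, Multiset.prod_singleton]
    change X - C ξ ∣ tailPoly _
    rw [dvd_iff_isRoot, tailPoly_add, tailPoly_single]
    simp [z, hv]
  · intro j
    by_cases hj : j = z
    · left
      rw [hj, ← h0, Pi.single_eq_same]
      rcases lt_or_gt_of_ne hξ with h | h
      · rw [sign_pos (neg_pos.2 (hodd.pow_neg h)), sign_pos (neg_pos.2 h)]
      · rw [sign_neg (neg_neg_of_pos (pow_pos h d)), sign_neg (neg_neg_of_pos h)]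
    · right
      refine ⟨Pi.single_eq_of_ne hj _, ?_⟩
      simp [hg, hj, sign_signType_cast]

lemma bernoulli_even_odd {d k : ℕ} (hd : Even d) (hk : Odd k) (hkd : k < d) {u : ℝ} (hu : u ≠ 1) :
    1 + (d / k : ℝ) * (u ^ k - 1) < u ^ d := by
  have hk0 : (0 : ℝ) < k := by exact_mod_cast hk.pos
  have hkd' : (k : ℝ) < d := by exact_mod_cast hkd
  have hp : 1 < (d / k : ℝ) := (one_lt_div hk0).2 hkd'
  by_cases h : |u| = 1
  · have : u = -1 := by
      rcases abs_choice u with h' | h' <;> [exact absurd (h'.symm.trans h) hu; linarith]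
    rw [this, hd.neg_one_pow, hk.neg_one_pow]
    linarith
  · have hle : u ^ k ≤ |u| ^ k := by rw [← abs_pow]; exact le_abs_self _
    have hne : |u| ^ k - 1 ≠ 0 := by
      intro h'
      exact h ((pow_eq_one_iff_of_nonneg (abs_nonneg u) hk.pos.ne').1 (by linarith))
    have hb := one_add_mul_self_lt_rpow_one_add
      (by linarith [pow_nonneg (abs_nonneg u) k] : -1 ≤ |u| ^ k - 1) hne hp
    have hr : (1 + (|u| ^ k - 1)) ^ (d / k : ℝ) = u ^ d := by
      rw [add_sub_cancel, ← Real.rpow_natCast, ← Real.rpow_mul (abs_nonneg u),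
        mul_div_cancel₀ _ hk0.ne', Real.rpow_natCast, hd.pow_abs]
    rw [hr] at hb
    have := mul_le_mul_of_nonneg_left hle (zero_lt_one.trans hp).le
    linarith

/-- `x ^ d`, with `d` even, is a strictly convex function of `x ^ k` for odd `k < d`. -/
lemma tangent_lt_pow {d k : ℕ} (hd : Even d) (hk : Odd k) (hkd : k < d) {c x : ℝ} (hx : x ≠ c) :
    c ^ d + (d / k : ℝ) * c ^ (d - k) * (x ^ k - c ^ k) < x ^ d := by
  by_cases hc : c = 0
  · subst hc
    rw [zero_pow (by omega), zero_pow (by omega)]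
    have := hd.pow_pos hx
    linarith
  · have hu : x / c ≠ 1 := fun h => hx ((div_eq_one_iff_eq hc).1 h)
    have h := mul_lt_mul_of_pos_right (bernoulli_even_odd hd hk hkd hu) (hd.pow_pos hc)
    rw [div_pow, div_pow, div_mul_cancel₀ _ (pow_ne_zero _ hc)] at h
    have h2 : c ^ d = c ^ (d - k) * c ^ k := by rw [← pow_add]; congr 1; omega
    calc _ = (1 + (d / k : ℝ) * (x ^ k / c ^ k - 1)) * c ^ d := by
          rw [h2]; field_simp
      _ < _ := h

/-- A real trinomial `X ^ d + A X ^ k + B` (`d` even, `k` odd) with two nonzero roots has no other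
real roots, and these are simple. -/
lemma roots_trinomial {d : ℕ} {k : ℕ} (hd : Even d) (hk : Odd k) (hkd : k < d) {ξ η A B : ℝ}
    (hlt : ξ < η) (hξ0 : ξ ≠ 0) (hη0 : η ≠ 0) (hξ : ξ ^ d + A * ξ ^ k + B = 0)
    (hη : η ^ d + A * η ^ k + B = 0) {p : ℝ[X]} (hp : p = X ^ d + (C A * X ^ k + C B))
    (hm : p.Monic) : p.roots = {ξ, η} := by
  have hk0 : (0 : ℝ) < k := by exact_mod_cast hk.pos
  have hev : ∀ x, p.eval x = x ^ d + A * x ^ k + B := fun x => by rw [hp]; simp [add_assoc]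
  have hmono := hk.strictMono_pow (R := ℝ)
  have hkl : ξ ^ k < η ^ k := hmono hlt
  set m : ℝ → ℝ := fun c => (d / k : ℝ) * c ^ (d - k) + A with hmdef
  have tan : ∀ {c x : ℝ}, x ≠ c → p.eval c + m c * (x ^ k - c ^ k) < p.eval x := by
    intro c x hx
    have := tangent_lt_pow hd hk hkd hx
    rw [hev, hev]
    simp only [hmdef]
    linarith
  have hpξ : p.eval ξ = 0 := by rw [hev, hξ]
  have hpη : p.eval η = 0 := by rw [hev, hη]
  have hmξ : m ξ < 0 := by
    have := tan hlt.ne'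
    rw [hpξ, hpη] at this
    by_contra hc
    nlinarith [mul_nonneg (not_lt.1 hc) (sub_pos.2 hkl).le]
  have hmη : 0 < m η := by
    have := tan hlt.ne
    rw [hpξ, hpη] at this
    by_contra hc
    nlinarith [mul_nonneg_of_nonpos_of_nonpos (not_lt.1 hc) (sub_neg.2 hkl).le]
  have hleft : ∀ x < ξ, 0 < p.eval x := fun x hx => by
    have h1 := tan hx.ne
    have h2 : x ^ k < ξ ^ k := hmono hx
    nlinarith [mul_pos_of_neg_of_neg hmξ (sub_neg.2 h2)]
  have hright : ∀ x, η < x → 0 < p.eval x := fun x hx => by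
    have h1 := tan hx.ne'
    have h2 : η ^ k < x ^ k := hmono hx
    nlinarith [mul_pos hmη (sub_pos.2 h2)]
  have hmid : ∀ x, ξ < x → x < η → p.eval x < 0 := fun x hx hx' => by
    have h1 := tan hx.ne
    have h2 := tan hx'.ne'
    have h3 : ξ ^ k < x ^ k := hmono hx
    have h4 : x ^ k < η ^ k := hmono hx'
    rw [hpξ] at h1
    rw [hpη] at h2
    rcases le_total (m x) 0 with h | h
    · nlinarith [mul_nonneg_of_nonpos_of_nonpos h (sub_neg.2 h3).le]
    · nlinarith [mul_nonneg h (sub_pos.2 h4).le]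
  have hder : ∀ c, p.derivative.eval c = k * c ^ (k - 1) * m c := by
    intro c
    have h1 : c ^ (d - 1) = c ^ (k - 1) * c ^ (d - k) := by
      rw [← pow_add]; congr 1; have := hk.pos; omega
    rw [hp]
    simp only [derivative_add, derivative_X_pow, derivative_C, derivative_C_mul, add_zero, eval_add,
      eval_mul, eval_pow, eval_X, eval_C, map_natCast, eval_natCast, h1, hmdef]
    field_simp
  have hke : Even (k - 1) := by
    obtain ⟨n, hn⟩ := hk
    exact ⟨n, by omega⟩
  obtain ⟨q, hq⟩ : (X - C ξ) * (X - C η) ∣ p :=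
    (isCoprime_X_sub_C_of_isUnit_sub (sub_ne_zero.2 hlt.ne).isUnit).mul_dvd
      (dvd_iff_isRoot.2 hpξ) (dvd_iff_isRoot.2 hpη)
  refine (Monic.roots_eq_iff hm _).2 ⟨q, by simpa using hq, fun x => ?_⟩
  have hx := congrArg (eval x) hq
  simp only [eval_mul, eval_sub, eval_X, eval_C] at hx
  rcases lt_trichotomy x ξ with h | h | h
  · have := hleft x h
    rw [hx] at this
    exact (mul_pos_iff_of_pos_left
      (mul_pos_of_neg_of_neg (by linarith) (by linarith))).1 this
  · subst h
    have h1 : p.derivative.eval x < 0 := by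
      rw [hder]
      exact mul_neg_of_pos_of_neg (mul_pos hk0 (hke.pow_pos hξ0)) hmξ
    rw [hq, mul_assoc, eval_self_derivative_X_sub_C_mul] at h1
    simp only [eval_mul, eval_sub, eval_X, eval_C] at h1
    exact pos_of_mul_neg_right h1 (by linarith)
  · rcases lt_trichotomy x η with h' | h' | h'
    · have := hmid x h h'
      rw [hx] at this
      exact pos_of_mul_neg_right this
        (mul_nonpos_of_nonneg_of_nonpos (by linarith) (by linarith))
    · subst h'
      have h1 : 0 < p.derivative.eval x := by
        rw [hder]
        exact mul_pos (mul_pos hk0 (hke.pow_pos hη0)) hmη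
      rw [hq, mul_comm (X - C ξ), mul_assoc, eval_self_derivative_X_sub_C_mul] at h1
      simp only [eval_mul, eval_sub, eval_X, eval_C] at h1
      exact (mul_pos_iff_of_pos_left (by linarith)).1 h1
    · have := hright x h'
      rw [hx] at this
      exact (mul_pos_iff_of_pos_left (mul_pos (by linarith) (by linarith))).1 this

lemma pair_prod_dvd {ξ η : ℝ} (hne : ξ ≠ η) {p : ℝ[X]} (h1 : p.eval ξ = 0) (h2 : p.eval η = 0) :
    (({ξ, η} : Multiset ℝ).map fun r => X - C r).prod ∣ p := by
  simpa using (isCoprime_X_sub_C_of_isUnit_sub (sub_ne_zero.2 hne).isUnit).mul_dvd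
    (dvd_iff_isRoot.2 h1) (dvd_iff_isRoot.2 h2)

lemma rootFiber_pair_nonempty {d : ℕ} (hd : 0 < d) (hev : Even d) {σ : Fin d → SignType}
    (hσ : ∀ j, σ j ≠ 0) {k : Fin d} (hk : Odd (k : ℕ)) {ξ η : ℝ} (hlt : ξ < η)
    (hsk : |η| < |ξ| ∧ σ k = 1 ∨ |ξ| < |η| ∧ σ k = -1)
    (hs0 : ξ < 0 ∧ 0 < η ∧ σ ⟨0, hd⟩ = -1 ∨ (0 < ξ ∨ η < 0) ∧ σ ⟨0, hd⟩ = 1) :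
    (rootFiber σ {ξ, η}).Nonempty := by
  have hξ0 : ξ ≠ 0 := by rintro rfl; simp at hs0; linarith [hs0.1]
  have hη0 : η ≠ 0 := by rintro rfl; simp at hs0; linarith [hs0.1]
  have hkz := ne_zero_of_odd_index hd hk
  set z : Fin d := ⟨0, hd⟩ with hz
  have hkl : ξ ^ (k : ℕ) < η ^ (k : ℕ) := hk.strictMono_pow hlt
  have hkl' := sub_pos.2 hkl
  set A : ℝ := (ξ ^ d - η ^ d) / (η ^ (k : ℕ) - ξ ^ (k : ℕ)) with hA
  have hAe : A * (η ^ (k : ℕ) - ξ ^ (k : ℕ)) = ξ ^ d - η ^ d := div_mul_cancel₀ _ hkl'.ne'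
  set B : ℝ := -(ξ ^ d + A * ξ ^ (k : ℕ)) with hB
  have hp : poly (Pi.single k A + Pi.single z B) = X ^ d + (C A * X ^ (k : ℕ) + C B) := by
    rw [poly_eq_add_tailPoly, tailPoly_add, tailPoly_single, tailPoly_single]
    simp [z]
  have hroots := roots_trinomial hev hk k.2 hlt hξ0 hη0 (by rw [hB]; ring)
    (by rw [hB]; linarith) hp (poly_monic _)
  have hB0 : (poly (Pi.single k A + Pi.single z B)).eval 0 = B := by
    rw [hp]; simp [hd.ne', hk.pos.ne']
  have hsg := eval_of_roots_pair (poly_monic _) hlt hroots 0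
  rw [hB0] at hsg
  have hσA : SignType.sign A = σ k := by
    rcases hsk with ⟨h, h'⟩ | ⟨h, h'⟩
    · rw [h', sign_eq_one_iff]
      have := pow_lt_pow_left₀ h (abs_nonneg _) hd.ne'
      rw [hev.pow_abs, hev.pow_abs] at this
      exact div_pos (by linarith) hkl'
    · rw [h', sign_eq_neg_one_iff]
      have := pow_lt_pow_left₀ h (abs_nonneg _) hd.ne'
      rw [hev.pow_abs, hev.pow_abs] at this
      exact div_neg_of_neg_of_pos (by linarith) hkl'
  have hσB : SignType.sign B = σ z := by
    rcases hs0 with ⟨h, h', h0⟩ | ⟨h, h0⟩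
    · rw [h0, sign_eq_neg_one_iff]; exact hsg.2.2 ⟨h, h'⟩
    · rw [h0, sign_eq_one_iff]; exact hsg.1.2 h
  set g : Fin d → ℝ := fun j => if j = z ∨ j = k then 0 else σ j with hg
  set u : ℝ := ((tailPoly g).eval ξ - (tailPoly g).eval η) / (η ^ (k : ℕ) - ξ ^ (k : ℕ)) with hu
  have hue : u * (η ^ (k : ℕ) - ξ ^ (k : ℕ)) = (tailPoly g).eval ξ - (tailPoly g).eval η :=
    div_mul_cancel₀ _ hkl'.ne'
  set v : ℝ := -((tailPoly g).eval ξ + u * ξ ^ (k : ℕ)) with hv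
  have hr : ∀ x, (tailPoly (g + Pi.single k u + Pi.single z v)).eval x =
      (tailPoly g).eval x + u * x ^ (k : ℕ) + v := fun x => by
    rw [tailPoly_add, tailPoly_add, tailPoly_single, tailPoly_single]; simp [z]
  refine rootFiber_nonempty_of_perturbation hσ hroots (r := g + Pi.single k u + Pi.single z v)
    (pair_prod_dvd hlt.ne (p := tailPoly _) (by rw [hr, hv]; ring) (by rw [hr, hv]; linarith))
    fun j => ?_
  by_cases hj : j = z
  · left; rw [hj]; simp [Pi.single_eq_of_ne hkz.symm, hσB]
  by_cases hjk : j = k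
  · left; rw [hjk]; simp [Pi.single_eq_of_ne hkz, hσA]
  · right
    simp [hg, hj, hjk, sign_signType_cast]

lemma rootFiber_symm_pair_nonempty {d : ℕ} (hd : 0 < d) (hev : Even d) {σ : Fin d → SignType}
    (hσ : ∀ j, σ j ≠ 0) {k l : Fin d} (hk : Odd (k : ℕ)) (hl : Odd (l : ℕ)) (hσk : σ k = 1)
    (hσl : σ l = -1) (h0 : σ ⟨0, hd⟩ = -1) {η : ℝ} (hη : 0 < η) :
    (rootFiber σ {-η, η}).Nonempty := by
  have hkz := ne_zero_of_odd_index hd hk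
  have hlz := ne_zero_of_odd_index hd hl
  have hkl : k ≠ l := by rintro rfl; rw [hσk] at hσl; exact absurd hσl (by decide)
  set z : Fin d := ⟨0, hd⟩ with hz
  have hlt : -η < η := by linarith
  have hp : poly (Pi.single z (-η ^ d)) = X ^ d + (C 0 * X ^ (k : ℕ) + C (-η ^ d)) := by
    rw [poly_eq_add_tailPoly, tailPoly_single]; simp [z]
  have hroots := roots_trinomial hev hk k.2 hlt (by linarith) hη.ne'
    (by rw [hev.neg_pow]; ring) (by ring) hp (poly_monic _)
  set g : Fin d → ℝ := fun j => if j = z ∨ j = k ∨ j = l then 0 else σ j with hg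
  set w : ℝ := ((tailPoly g).eval η - (tailPoly g).eval (-η)) / 2 with hw
  set M : ℝ := |w| + 1 with hM
  set u : ℝ := (M - w) / η ^ (k : ℕ) with hu
  set u' : ℝ := -M / η ^ (l : ℕ) with hu'
  set v : ℝ := w - (tailPoly g).eval η with hv
  have hupos : 0 < u := div_pos (by linarith [le_abs_self w]) (by positivity)
  have hu'neg : u' < 0 := div_neg_of_neg_of_pos (by linarith [abs_nonneg w]) (by positivity)
  have hue : u * η ^ (k : ℕ) = M - w := div_mul_cancel₀ _ (by positivity)
  have hu'e : u' * η ^ (l : ℕ) = -M := div_mul_cancel₀ _ (by positivity)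
  have hr : ∀ x, (tailPoly (g + Pi.single k u + Pi.single l u' + Pi.single z v)).eval x =
      (tailPoly g).eval x + u * x ^ (k : ℕ) + u' * x ^ (l : ℕ) + v := fun x => by
    rw [tailPoly_add, tailPoly_add, tailPoly_add, tailPoly_single, tailPoly_single,
      tailPoly_single]
    simp [z]
  refine rootFiber_nonempty_of_perturbation hσ hroots
    (r := g + Pi.single k u + Pi.single l u' + Pi.single z v)
    (pair_prod_dvd hlt.ne (p := tailPoly _) ?_ ?_) fun j => ?_
  · rw [hr, hk.neg_pow, hl.neg_pow]; linarith
  · rw [hr]; linarith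
  by_cases hj : j = z
  · left; rw [hj, h0]; simp [hη]
  right
  refine ⟨Pi.single_eq_of_ne hj _, ?_⟩
  by_cases hjk : j = k
  · rw [hjk, hσk]; simp [Pi.single_eq_of_ne hkz, Pi.single_eq_of_ne hkl, hg, hupos]
  by_cases hjl : j = l
  · rw [hjl, hσl]; simp [Pi.single_eq_of_ne hlz, Pi.single_eq_of_ne hkl.symm, hg, hu'neg]
  · simp [hg, hj, hjk, hjl,
      sign_signType_cast]

lemma ellipticSet_eq {d : ℕ} (σ : Fin d → SignType) : ellipticSet σ = rootFiber σ 0 := by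
  ext a
  refine and_congr_right fun _ => ?_
  rw [Multiset.eq_zero_iff_forall_notMem]
  refine forall_congr' fun x => not_congr ?_
  rw [mem_roots (poly_monic a).ne_zero]

lemma eval_neg_lt_eval {d : ℕ} (hd : 0 < d) (hev : Even d) {a : Fin d → ℝ} {s x : ℝ}
    (ha : ∀ j : Fin d, Odd (j : ℕ) → 0 < s * a j) (hx : 0 < x) :
    s * (poly a).eval (-x) < s * (poly a).eval x := by
  have h1 : 1 < d := by
    obtain ⟨m, hm⟩ := hev
    omega
  rw [poly_eval, poly_eval, hev.neg_pow, mul_add, mul_add, Finset.mul_sum, Finset.mul_sum]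
  refine add_lt_add_right (Finset.sum_lt_sum (fun j _ => ?_) ⟨⟨1, h1⟩, Finset.mem_univ _, ?_⟩) _
  · rcases Nat.even_or_odd (j : ℕ) with hj | hj
    · rw [hj.neg_pow]
    · rw [hj.neg_pow]
      have := mul_pos (ha j hj) (pow_pos hx (j : ℕ))
      linarith
  · have := mul_pos (ha ⟨1, h1⟩ odd_one) hx
    simp only [pow_one]
    linarith

lemma sign_eq_one_or {σ : SignType} (h : σ ≠ 0) : σ = 1 ∨ σ = -1 := by
  revert h; revert σ; decide

section

variable {d : ℕ} {σ : Fin d → SignType}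

lemma eval_neg_lt_eval_of_signs (hd : 0 < d) (hev : Even d) {a : Fin d → ℝ}
    (ha : a ∈ signRegion σ) (h : ∀ j : Fin d, Odd (j : ℕ) → σ j = 1) {x : ℝ} (hx : 0 < x) :
    (poly a).eval (-x) < (poly a).eval x := by
  have := eval_neg_lt_eval hd hev (a := a) (s := 1) (fun j hj => by
    rw [one_mul]; exact sign_eq_one_iff.1 ((ha j).trans (h j hj))) hx
  linarith

lemma eval_lt_eval_neg_of_signs (hd : 0 < d) (hev : Even d) {a : Fin d → ℝ}
    (ha : a ∈ signRegion σ) (h : ∀ j : Fin d, Odd (j : ℕ) → σ j = -1) {x : ℝ} (hx : 0 < x) :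
    (poly a).eval x < (poly a).eval (-x) := by
  have := eval_neg_lt_eval hd hev (a := a) (s := -1) (fun j hj => by
    have := sign_eq_neg_one_iff.1 ((ha j).trans (h j hj))
    linarith) hx
  linarith

lemma twoRootSetPos_eq : twoRootSetPos σ =
    {a | ∃ p ∈ {p : ℝ × ℝ | 0 < p.1 ∧ p.1 < p.2}, a ∈ rootFiber σ {p.1, p.2}} := by
  ext a
  constructor
  · rintro ⟨ha, ξ, η, h1, h2, h⟩
    exact ⟨(ξ, η), ⟨h1, h2⟩, ha, h⟩
  · rintro ⟨p, ⟨h1, h2⟩, ha, h⟩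
    exact ⟨ha, p.1, p.2, h1, h2, h⟩

lemma twoRootSetNeg_eq : twoRootSetNeg σ =
    {a | ∃ p ∈ {p : ℝ × ℝ | p.1 < p.2 ∧ p.2 < 0}, a ∈ rootFiber σ {p.1, p.2}} := by
  ext a
  constructor
  · rintro ⟨ha, ξ, η, h1, h2, h⟩
    exact ⟨(ξ, η), ⟨h1, h2⟩, ha, h⟩
  · rintro ⟨p, ⟨h1, h2⟩, ha, h⟩
    exact ⟨ha, p.1, p.2, h1, h2, h⟩

lemma convex_lt_fst_snd : Convex ℝ {p : ℝ × ℝ | p.1 < p.2} := by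
  intro p hp q hq s t hs ht hst
  simp only [mem_ofPred_eq] at hp hq
  have h := (convex_Ioi (0 : ℝ)) (x := p.2 - p.1) (by simp; linarith) (y := q.2 - q.1)
    (by simp; linarith) hs ht hst
  simp only [mem_Ioi, smul_eq_mul, mem_ofPred_eq, Prod.fst_add, Prod.snd_add, Prod.smul_fst,
    Prod.smul_snd] at h ⊢
  linarith

lemma convex_neg_fst_lt_snd : Convex ℝ {p : ℝ × ℝ | -p.1 < p.2} := by
  intro p hp q hq s t hs ht hst
  simp only [mem_ofPred_eq] at hp hq
  have h := (convex_Ioi (0 : ℝ)) (x := p.2 + p.1) (by simp; linarith) (y := q.2 + q.1)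
    (by simp; linarith) hs ht hst
  simp only [mem_Ioi, smul_eq_mul, mem_ofPred_eq, Prod.fst_add, Prod.snd_add, Prod.smul_fst,
    Prod.smul_snd] at h ⊢
  linarith

lemma convex_snd_lt_neg_fst : Convex ℝ {p : ℝ × ℝ | p.2 < -p.1} := by
  intro p hp q hq s t hs ht hst
  simp only [mem_ofPred_eq] at hp hq
  have h := (convex_Iio (0 : ℝ)) (x := p.2 + p.1) (by simp; linarith) (y := q.2 + q.1)
    (by simp; linarith) hs ht hst
  simp only [mem_Iio, smul_eq_mul, mem_ofPred_eq, Prod.fst_add, Prod.snd_add, Prod.smul_fst,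
    Prod.smul_snd] at h ⊢
  linarith

lemma convex_fst_neg_snd_pos : Convex ℝ {p : ℝ × ℝ | p.1 < 0 ∧ 0 < p.2} :=
  (convex_Iio (0 : ℝ)).prod (convex_Ioi (0 : ℝ))

lemma contractibleSpace_twoRootSetPos (hd : 0 < d) (hev : Even d) (hσ : ∀ j, σ j ≠ 0)
    (h0 : σ ⟨0, hd⟩ = 1) {k : Fin d} (hk : Odd (k : ℕ)) (hσk : σ k = -1) :
    ContractibleSpace (twoRootSetPos σ) := by
  rw [twoRootSetPos_eq]
  refine contractibleSpace_iUnion_pair hσ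
    (((convex_Ioi (0 : ℝ)).linear_preimage (LinearMap.fst ℝ ℝ ℝ)).inter convex_lt_fst_snd)
    ⟨(1, 2), by norm_num⟩ (fun p hp => hp.2) fun p hp => ?_
  refine rootFiber_pair_nonempty hd hev hσ hk hp.2 (Or.inr ⟨?_, hσk⟩) (Or.inr ⟨Or.inl hp.1, h0⟩)
  rw [abs_of_pos hp.1, abs_of_pos (hp.1.trans hp.2)]
  exact hp.2

lemma contractibleSpace_twoRootSetNeg (hd : 0 < d) (hev : Even d) (hσ : ∀ j, σ j ≠ 0)
    (h0 : σ ⟨0, hd⟩ = 1) {k : Fin d} (hk : Odd (k : ℕ)) (hσk : σ k = 1) :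
    ContractibleSpace (twoRootSetNeg σ) := by
  rw [twoRootSetNeg_eq]
  refine contractibleSpace_iUnion_pair hσ
    (convex_lt_fst_snd.inter ((convex_Iio (0 : ℝ)).linear_preimage (LinearMap.snd ℝ ℝ ℝ)))
    ⟨(-2, -1), by norm_num⟩ (fun p hp => hp.1) fun p hp => ?_
  refine rootFiber_pair_nonempty hd hev hσ hk hp.1 (Or.inl ⟨?_, hσk⟩) (Or.inr ⟨Or.inr hp.2, h0⟩)
  rw [abs_of_neg hp.2, abs_of_neg (hp.1.trans hp.2)]
  exact neg_lt_neg hp.1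

lemma twoRootSetPos_eq_empty (hd : 0 < d) (hev : Even d)
    (h : ∀ j : Fin d, Odd (j : ℕ) → σ j = 1) : twoRootSetPos σ = ∅ := by
  refine eq_empty_iff_forall_notMem.2 ?_
  rintro a ⟨ha, ξ, η, h1, h2, hr⟩
  have hs := eval_of_roots_pair (poly_monic a) h2 hr
  obtain ⟨c, hc1, hc2⟩ := exists_between h2
  have h3 := (hs c).2.2 ⟨hc1, hc2⟩
  have h4 := (hs (-c)).1.2 (Or.inl (by linarith))
  linarith [eval_neg_lt_eval_of_signs hd hev ha h (h1.trans hc1)]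

lemma twoRootSetNeg_eq_empty (hd : 0 < d) (hev : Even d)
    (h : ∀ j : Fin d, Odd (j : ℕ) → σ j = -1) : twoRootSetNeg σ = ∅ := by
  refine eq_empty_iff_forall_notMem.2 ?_
  rintro a ⟨ha, ξ, η, h1, h2, hr⟩
  have hs := eval_of_roots_pair (poly_monic a) h1 hr
  obtain ⟨c, hc1, hc2⟩ := exists_between h1
  have h3 := (hs c).2.2 ⟨hc1, hc2⟩
  have h4 := (hs (-c)).1.2 (Or.inr (by linarith))
  have := eval_lt_eval_neg_of_signs hd hev ha h (x := -c) (by linarith)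
  rw [neg_neg] at this
  linarith

lemma twoRootSet_eq_opposite (hd : 0 < d) (h0 : σ ⟨0, hd⟩ = -1) :
    twoRootSet σ = twoRootSetOpposite σ := by
  ext a
  constructor
  · rintro ⟨ha, ξ, η, h, hr⟩
    have h1 : (poly a).eval 0 < 0 := by
      rw [poly_eval_zero hd]
      exact sign_eq_neg_one_iff.1 ((ha _).trans h0)
    obtain ⟨h2, h3⟩ := (eval_of_roots_pair (poly_monic a) h hr 0).2.1 h1
    exact ⟨ha, ξ, η, h2, h3, hr⟩
  · rintro ⟨ha, ξ, η, h1, h2, hr⟩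
    exact ⟨ha, ξ, η, h1.trans h2, hr⟩

lemma contractibleSpace_twoRootSetOpposite (hd : 0 < d) (hev : Even d) (hσ : ∀ j, σ j ≠ 0)
    (h0 : σ ⟨0, hd⟩ = -1) : ContractibleSpace (twoRootSetOpposite σ) := by
  have h1 : 1 < d := by
    obtain ⟨m, hm⟩ := hev
    omega
  have mk : ∀ B : Set (ℝ × ℝ), Convex ℝ B → B.Nonempty → (∀ p ∈ B, p.1 < 0 ∧ 0 < p.2) →
      (∀ p ∈ B, (rootFiber σ {p.1, p.2}).Nonempty) →
      (∀ a ∈ signRegion σ, ∀ p : ℝ × ℝ, p.1 < 0 → 0 < p.2 → (poly a).roots = {p.1, p.2} → p ∈ B) →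
      ContractibleSpace (twoRootSetOpposite σ) := by
    intro B hB hne hsub hfib hmem
    have : twoRootSetOpposite σ = {a | ∃ p ∈ B, a ∈ rootFiber σ {p.1, p.2}} := by
      ext a
      constructor
      · rintro ⟨ha, ξ, η, h2, h3, h⟩
        exact ⟨(ξ, η), hmem a ha (ξ, η) h2 h3 h, ha, h⟩
      · rintro ⟨p, hp, ha, h⟩
        exact ⟨ha, p.1, p.2, (hsub p hp).1, (hsub p hp).2, h⟩
    rw [this]
    exact contractibleSpace_iUnion_pair hσ hB hne
      (fun p hp => (hsub p hp).1.trans (hsub p hp).2) hfib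
  by_cases hpos : ∀ j : Fin d, Odd (j : ℕ) → σ j = 1
  · refine mk ({p | p.1 < 0 ∧ 0 < p.2} ∩ {p | p.2 < -p.1})
      (convex_fst_neg_snd_pos.inter convex_snd_lt_neg_fst) ⟨(-2, 1), by norm_num⟩
      (fun p hp => hp.1) (fun p hp => ?_) fun a ha p hp1 hp2 hr => ⟨⟨hp1, hp2⟩, ?_⟩
    · refine rootFiber_pair_nonempty hd hev hσ (k := ⟨1, h1⟩) odd_one (hp.1.1.trans hp.1.2)
        (Or.inl ⟨?_, hpos _ odd_one⟩) (Or.inl ⟨hp.1.1, hp.1.2, h0⟩)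
      rw [abs_of_pos hp.1.2, abs_of_neg hp.1.1]
      exact hp.2
    · have hlt := eval_neg_lt_eval_of_signs hd hev ha hpos hp2
      have he := eval_of_roots_pair (poly_monic a) (hp1.trans hp2) hr
      have h2 : ¬ 0 < (poly a).eval p.2 := by
        rw [(he p.2).1]; simp [(hp1.trans hp2).le]
      have h3 := ((he (-p.2)).2.1 (by linarith)).1
      change p.2 < -p.1
      linarith
  by_cases hneg : ∀ j : Fin d, Odd (j : ℕ) → σ j = -1
  · refine mk ({p | p.1 < 0 ∧ 0 < p.2} ∩ {p | -p.1 < p.2})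
      (convex_fst_neg_snd_pos.inter convex_neg_fst_lt_snd) ⟨(-1, 2), by norm_num⟩
      (fun p hp => hp.1) (fun p hp => ?_) fun a ha p hp1 hp2 hr => ⟨⟨hp1, hp2⟩, ?_⟩
    · refine rootFiber_pair_nonempty hd hev hσ (k := ⟨1, h1⟩) odd_one (hp.1.1.trans hp.1.2)
        (Or.inr ⟨?_, hneg _ odd_one⟩) (Or.inl ⟨hp.1.1, hp.1.2, h0⟩)
      rw [abs_of_pos hp.1.2, abs_of_neg hp.1.1]
      exact hp.2
    · have hlt := eval_lt_eval_neg_of_signs hd hev ha hneg (neg_pos.2 hp1)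
      rw [neg_neg] at hlt
      have he := eval_of_roots_pair (poly_monic a) (hp1.trans hp2) hr
      have h2 : ¬ 0 < (poly a).eval p.1 := by
        rw [(he p.1).1]; simp [(hp1.trans hp2).le]
      exact ((he (-p.1)).2.1 (by linarith)).2
  push Not at hpos hneg
  obtain ⟨l, hl, hσl⟩ := hpos
  obtain ⟨k, hk, hσk⟩ := hneg
  have hσl := (sign_eq_one_or (hσ l)).resolve_left hσl
  have hσk := (sign_eq_one_or (hσ k)).resolve_right hσk
  refine mk {p | p.1 < 0 ∧ 0 < p.2} convex_fst_neg_snd_pos ⟨(-1, 1), by norm_num⟩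
    (fun p hp => hp) (fun p hp => ?_) fun a ha p hp1 hp2 hr => ⟨hp1, hp2⟩
  rcases lt_trichotomy (-p.1) p.2 with h | h | h
  · refine rootFiber_pair_nonempty hd hev hσ hl (hp.1.trans hp.2)
      (Or.inr ⟨?_, hσl⟩) (Or.inl ⟨hp.1, hp.2, h0⟩)
    rwa [abs_of_pos hp.2, abs_of_neg hp.1]
  · have : p.1 = -p.2 := by linarith
    rw [this]
    exact rootFiber_symm_pair_nonempty hd hev hσ hk hl hσk hσl h0 hp.2
  · refine rootFiber_pair_nonempty hd hev hσ hk (hp.1.trans hp.2)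
      (Or.inl ⟨?_, hσk⟩) (Or.inl ⟨hp.1, hp.2, h0⟩)
    rwa [abs_of_pos hp.2, abs_of_neg hp.1]

lemma oneRootSet_nonempty_and_contractibleSpace (hd : 0 < d) (hodd : Odd d)
    (hσ : ∀ j, σ j ≠ 0) : (oneRootSet σ).Nonempty ∧ ContractibleSpace (oneRootSet σ) := by
  set B : Set ℝ := {ξ | SignType.sign (-ξ) = σ ⟨0, hd⟩} with hB
  have hfib : ∀ ξ ∈ B, (rootFiber σ {ξ}).Nonempty := fun ξ hξ =>
    rootFiber_singleton_nonempty hd hodd hσ hξ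
  have hS : oneRootSet σ = {a | ∃ ξ ∈ B, a ∈ rootFiber σ {ξ}} := by
    ext a
    constructor
    · rintro ⟨ha, ξ, hr⟩
      refine ⟨ξ, ?_, ha, hr⟩
      change SignType.sign (-ξ) = _
      rw [← ha, ← poly_eval_zero hd a]
      have he := eval_of_roots_singleton (poly_monic a) hr 0
      rcases lt_trichotomy ξ 0 with h | h | h
      · rw [sign_pos (neg_pos.2 h), sign_pos (he.1.2 h)]
      · have : (poly a).eval 0 = 0 :=
          le_antisymm (not_lt.1 fun h' => (he.1.1 h').ne h) (not_lt.1 fun h' => (he.2.1 h').ne' h)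
        rw [h, this, neg_zero]
      · rw [sign_neg (neg_neg_of_pos h), sign_neg (he.2.2 h)]
    · rintro ⟨ξ, -, ha, hr⟩
      exact ⟨ha, ξ, hr⟩
  have hBc : Convex ℝ B ∧ B.Nonempty := by
    rcases sign_eq_one_or (hσ ⟨0, hd⟩) with h | h
    · have : B = Iio 0 := by
        ext ξ; simp [hB, h, sign_eq_one_iff]
      rw [this]
      exact ⟨convex_Iio 0, nonempty_Iio⟩
    · have : B = Ioi 0 := by
        ext ξ; simp [hB, h, sign_eq_neg_one_iff]
      rw [this]
      exact ⟨convex_Ioi 0, nonempty_Ioi⟩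
  have hc : ContractibleSpace (oneRootSet σ) := by
    rw [hS]
    exact contractibleSpace_iUnion_singleton hσ hBc.1 hBc.2 hfib
  refine ⟨?_, hc⟩
  obtain ⟨ξ, hξ⟩ := hBc.2
  obtain ⟨a, ha⟩ := hfib ξ hξ
  exact ⟨a, ha.1, ξ, ha.2⟩

lemma case1_or_all_pos_iff (hd : 0 < d) (hσ : ∀ j, σ j ≠ 0) (h0 : σ ⟨0, hd⟩ = 1) :
    (Case1 σ ∨ ∀ j, σ j = 1) ↔ ∀ j : Fin d, Odd (j : ℕ) → σ j = 1 := by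
  constructor
  · rintro (h | h) j hj
    · exact h.2.1 j hj
    · exact h j
  · intro h
    by_cases hall : ∀ j, σ j = 1
    · exact Or.inr hall
    · push Not at hall
      obtain ⟨j, hj⟩ := hall
      refine Or.inl ⟨fun i hi => ?_, h, j, ?_, (sign_eq_one_or (hσ j)).resolve_left hj⟩
      · rwa [show i = ⟨0, hd⟩ from Fin.ext hi]
      · exact Nat.not_odd_iff_even.1 fun hjo => hj (h j hjo)

lemma case2_or_alternating_iff (hd : 0 < d) (hσ : ∀ j, σ j ≠ 0) (h0 : σ ⟨0, hd⟩ = 1) :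
    (Case2 σ ∨ ∀ j : Fin d, σ j = (-1) ^ (j : ℕ)) ↔ ∀ j : Fin d, Odd (j : ℕ) → σ j = -1 := by
  constructor
  · rintro (h | h) j hj
    · exact h.2.1 j hj
    · rw [h j, hj.neg_one_pow]
  · intro h
    by_cases hall : ∀ j : Fin d, σ j = (-1) ^ (j : ℕ)
    · exact Or.inr hall
    · push Not at hall
      obtain ⟨j, hj⟩ := hall
      have hje : Even (j : ℕ) :=
        Nat.not_odd_iff_even.1 fun hjo => hj (by rw [h j hjo, hjo.neg_one_pow])
      rw [hje.neg_one_pow] at hj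
      refine Or.inl ⟨fun i hi => ?_, h, j, hje, (sign_eq_one_or (hσ j)).resolve_left hj⟩
      rwa [show i = ⟨0, hd⟩ from Fin.ext hi]

end

end SignedPoly

theorem theorem1 (d : ℕ) (hd : 0 < d) (σ : Fin d → SignType) (hσ : ∀ j, σ j ≠ 0) :
    -- (1) no real roots
    (Even d → σ ⟨0, hd⟩ = 1 →
      (SignedPoly.ellipticSet σ).Nonempty ∧ Convex ℝ (SignedPoly.ellipticSet σ) ∧
        ContractibleSpace (SignedPoly.ellipticSet σ)) ∧
    -- (2) exactly one real root
    (Odd d →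
      (SignedPoly.oneRootSet σ).Nonempty ∧ ContractibleSpace (SignedPoly.oneRootSet σ)) ∧
    -- (3) two simple real roots, negative constant term
    (Even d → σ ⟨0, hd⟩ = -1 →
      SignedPoly.twoRootSet σ = SignedPoly.twoRootSetOpposite σ ∧
        ContractibleSpace (SignedPoly.twoRootSet σ)) ∧
    -- (3) two simple real roots, positive constant term
    (Even d → σ ⟨0, hd⟩ = 1 →
      ((SignedPoly.twoRootSetPos σ = ∅ ∨ ContractibleSpace (SignedPoly.twoRootSetPos σ)) ∧
        (SignedPoly.twoRootSetPos σ = ∅ ↔ SignedPoly.Case1 σ ∨ ∀ j, σ j = 1)) ∧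
      ((SignedPoly.twoRootSetNeg σ = ∅ ∨ ContractibleSpace (SignedPoly.twoRootSetNeg σ)) ∧
        (SignedPoly.twoRootSetNeg σ = ∅ ↔
          SignedPoly.Case2 σ ∨ ∀ j : Fin d, σ j = (-1) ^ (j : ℕ)))) := by
  refine ⟨fun hev h0 => ?_, fun hodd =>
    SignedPoly.oneRootSet_nonempty_and_contractibleSpace hd hodd hσ, fun hev h0 => ?_,
    fun hev h0 => ⟨?_, ?_⟩⟩
  · rw [SignedPoly.ellipticSet_eq]
    have hne := SignedPoly.rootFiber_zero_nonempty hd hev hσ h0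
    have hc := SignedPoly.convex_rootFiber σ hσ 0
    exact ⟨hne, hc, hc.contractibleSpace hne⟩
  · have h := SignedPoly.twoRootSet_eq_opposite hd h0
    exact ⟨h, h ▸ SignedPoly.contractibleSpace_twoRootSetOpposite hd hev hσ h0⟩
  · rw [SignedPoly.case1_or_all_pos_iff hd hσ h0]
    by_cases h : ∀ j : Fin d, Odd (j : ℕ) → σ j = 1
    · have he := SignedPoly.twoRootSetPos_eq_empty hd hev h
      exact ⟨Or.inl he, iff_of_true he h⟩
    · have h' := h
      push Not at h'
      obtain ⟨k, hk, hσk⟩ := h'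
      have hc := SignedPoly.contractibleSpace_twoRootSetPos hd hev hσ h0 hk
        ((SignedPoly.sign_eq_one_or (hσ k)).resolve_left hσk)
      have hne : (SignedPoly.twoRootSetPos σ).Nonempty := Set.nonempty_coe_sort.1 inferInstance
      exact ⟨Or.inr hc, iff_of_false hne.ne_empty h⟩
  · rw [SignedPoly.case2_or_alternating_iff hd hσ h0]
    by_cases h : ∀ j : Fin d, Odd (j : ℕ) → σ j = -1
    · have he := SignedPoly.twoRootSetNeg_eq_empty hd hev h
      exact ⟨Or.inl he, iff_of_true he h⟩
    · have h' := h
      push Not at h'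
      obtain ⟨k, hk, hσk⟩ := h'
      have hc := SignedPoly.contractibleSpace_twoRootSetNeg hd hev hσ h0 hk
        ((SignedPoly.sign_eq_one_or (hσ k)).resolve_right hσk)
      have hne : (SignedPoly.twoRootSetNeg σ).Nonempty := Set.nonempty_coe_sort.1 inferInstance
      exact ⟨Or.inr hc, iff_of_false hne.ne_empty h⟩
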